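/- Let $M=\mathbb S^1=\mathbb R/\mathbb Z$, let $L=\frac12\frac{\partial^2}{\partial x^2}$ act on $C^2(M)$, and let $V:M\to\mathbb R$ be Lipschitz. Let $\lambda_V$ be the largest eigenvalue of $L+V$ (with eigenfunctions in $C^2(M)$) and let $F\in C^2(M)$, $F>0$, satisfy $(L+V)F=\lambda_V F$. Put $$\mathcal L_V f=\frac1F (L+V)(Ff)-\lambda_V f,\qquad f\in C^2(M).$$ On the space $\mathcal C$ of continuous paths $w:[0,\infty)\to M$, with the coordinate process $X_t(w)=w_t$ and its canonical filtration $\mathcal F_t=\sigma(X_s:s\le t)$, let $\mathbb P_x$ be the law of Brownian motion on $M$ started at $x$, and let $\mathbb P_x^V$ (the Gibbs path measure) be the law of the diffusion started at $x$ with generator $\mathcal L_V$, that is, a probability measure with $w_0=x$ almost surely under which $f(X_t)-f(X_0)-\int_0^t \mathcal L_Vf(X_r)\,dr$ is an $(\mathcal F_t)$-martingale for every $f\in C^2(M)$. Then for every $x\in M$ and every $t\ge 0$, $\mathbb P_x^V$ is absolutely continuous with respect to $\mathbb P_x$ on $\mathcal F_t$, and $$\frac{d\mathbb P^V_x}{d\mathbb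 P_x}\Big|_{\mathcal F_t}(w)=\exp\Big\{\log F(w_t)-\log F(w_0)-\int_0^t\big(\lambda_V-V(w_r)\big)\,dr\Big\}\qquad \mathbb P_x\text{-a.s.}$$ Call a family $(\tilde{\mathbb P}_x)_{x\in M}$ of path measures admissible with $g\in C^2(M)$ if, for all $x\in M$ and all $T\ge0$, $$\frac{d\tilde{\mathbb P}_x}{d\mathbb P_x}\Big|_{\mathcal F_T}=\exp\Big\{g(X_T)-g(X_0)-\frac12\int_0^T\Big[\frac{\partial^2 g}{\partial x^2}(X_r)+\Big(\frac{\partial g}{\partial x}\Big)^2(X_r)\Big]dr\Big\}.$$ Consequently the Gibbs process $(\mathbb P^V_x)_{x\in M}$ is admissible, with $g=\log F\in C^2(M)$. -/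

import Mathlib

open MeasureTheory ProbabilityTheory
open scoped NNReal ENNReal

namespace CircleGibbs

noncomputable section

/-- The state space `M = 𝕊¹`: the interval `[0,1]` with `0` and `1` identified. -/
abbrev M : Type := UnitAddCircle

/-- `f ∈ C²(M)`: the `1`-periodic lift of `f` to the real line is of class `C²`. -/
def IsC2 (f : M → ℝ) : Prop := ContDiff ℝ 2 (fun y : ℝ => f (y : M))

/-- The derivative `∂f/∂x` of a function on the circle. -/
def circleDeriv (f : M → ℝ) (x : M) : ℝ := deriv (fun h : ℝ => f (x + (h : M))) 0

/-- `L f = ½ ∂²f/∂x²`, for `f ∈ C²(M)`. -/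
def genL (f : M → ℝ) (x : M) : ℝ := (1 / 2) * circleDeriv (circleDeriv f) x

/-- `(L + V) f = ½ ∂²f/∂x² + V f`, for `f ∈ C²(M)`. -/
def schrodinger (V f : M → ℝ) (x : M) : ℝ := genL f x + V x * f x

/-- `κ` is an eigenvalue of `L + V`. -/
def IsEigenvalue (V : M → ℝ) (κ : ℝ) : Prop :=
  ∃ f : M → ℝ, IsC2 f ∧ f ≠ 0 ∧ ∀ x, schrodinger V f x = κ * f x

/-- `lam` is the largest eigenvalue of `L + V` and `F` is a positive eigenfunction for it. -/
structure IsPrincipalEigenpair (V : M → ℝ) (lam : ℝ) (F : M → ℝ) : Prop where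
  isGreatest : IsGreatest {κ : ℝ | IsEigenvalue V κ} lam
  isC2 : IsC2 F
  pos : ∀ x, 0 < F x
  eigen : ∀ x, schrodinger V F x = lam * F x

/-- The operator `𝓛_V f = F⁻¹ (L + V)(F f) - lam f`, for `f ∈ C²(M)`. -/
def genGibbs (V : M → ℝ) (lam : ℝ) (F f : M → ℝ) (x : M) : ℝ :=
  (1 / F x) * schrodinger V (fun y => F y * f y) x - f x * lam

/-- The space of continuous paths `w : [0, ∞) → M`, with the σ-algebra generated by the
coordinates `w ↦ w t` (the one that a subtype inherits from the product). -/
abbrev PathSpace : Type := {w : ℝ≥0 → M // Continuous w}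

/-- The coordinate process `X_t(w) = w_t`. -/
def coord (t : ℝ≥0) (w : PathSpace) : M := w.1 t

theorem measurable_coord (t : ℝ≥0) : Measurable (coord t) :=
  (measurable_pi_apply t).comp measurable_subtype_coe

/-- The canonical filtration `𝓕_t = σ(X_s, s ≤ t)`. -/
def canonicalFiltration : Filtration ℝ≥0 (inferInstance : MeasurableSpace PathSpace) :=
  Filtration.natural coord fun t => (measurable_coord t).stronglyMeasurable

/-- The time integral `∫₀ᵗ φ(w_r) dr` along a path. -/
def pathIntegral (φ : M → ℝ) (t : ℝ≥0) (w : PathSpace) : ℝ :=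
  ∫ r in (0 : ℝ)..(t : ℝ), φ (coord r.toNNReal w)

/-- `P` is the law `ℙ_x` of Brownian motion on the circle started at `x`: the path starts at `x`,
its increments are independent, and `w_t - w_s` is a centred Gaussian variable with
variance `t - s`, taken modulo `1`. -/
structure IsBrownianLaw (x : M) (P : Measure PathSpace) : Prop where
  isProbabilityMeasure : IsProbabilityMeasure P
  start : ∀ᵐ w ∂P, coord 0 w = x
  indep : HasIndepIncrements coord P
  increment : ∀ s t : ℝ≥0, s ≤ t →
    P.map (fun w => coord t w - coord s w) =
      (gaussianReal 0 (t - s)).map (fun y : ℝ => (y : M))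

/-- `Q` is the law on path space of the diffusion started at `x` whose generator acts on `C²(M)`
as `A`, in the sense of the martingale problem: for each `f ∈ C²(M)` the process
`f(X_t) - f(X_0) - ∫₀ᵗ A f(X_r) dr` is a martingale for the canonical filtration. -/
structure IsDiffusionLaw (A : (M → ℝ) → M → ℝ) (x : M) (Q : Measure PathSpace) : Prop where
  isProbabilityMeasure : IsProbabilityMeasure Q
  start : ∀ᵐ w ∂Q, coord 0 w = x
  martingale : ∀ f : M → ℝ, IsC2 f →
    Martingale (fun (t : ℝ≥0) w => f (coord t w) - f (coord 0 w) - pathIntegral (A f) t w)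
      canonicalFiltration Q

/-- `Q` is the Gibbs path measure `ℙ_x^V`: the law of the process with generator `𝓛_V` started
at `x`. -/
def IsGibbsLaw (V : M → ℝ) (lam : ℝ) (F : M → ℝ) (x : M) (Q : Measure PathSpace) : Prop :=
  IsDiffusionLaw (genGibbs V lam F) x Q

/-- The restriction of `Q` to `𝓕_t` is absolutely continuous with respect to the restriction
of `P` to `𝓕_t`, with Radon–Nikodym density `D`. -/
def HasDensityOn (t : ℝ≥0) (Q P : Measure PathSpace) (D : PathSpace → ℝ≥0∞) : Prop :=
  Measurable[canonicalFiltration t] D ∧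
    Q.trim (canonicalFiltration.le t) = (P.trim (canonicalFiltration.le t)).withDensity D

/-- The process with path measures `Q x`, `x ∈ M`, is admissible with the function `g`, relative to
the family `P x` of Brownian laws: `g ∈ C²(M)` and, for each starting point `x` and each time `t`,
the density of `Q x` with respect to `P x` on `𝓕_t` is
`exp(g(X_t) - g(X_0) - ½ ∫₀ᵗ (g'' + (g')²)(X_r) dr)`. -/
def IsAdmissibleWith (P Q : M → Measure PathSpace) (g : M → ℝ) : Prop :=
  IsC2 g ∧ ∀ (x : M) (t : ℝ≥0), HasDensityOn t (Q x) (P x) fun w =>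
    ENNReal.ofReal (Real.exp (g (coord t w) - g (coord 0 w) - (1 / 2) *
      pathIntegral (fun y => circleDeriv (circleDeriv g) y + circleDeriv g y ^ 2) t w))

/-- Admissible: admissible with some `g ∈ C²(M)`. -/
def IsAdmissible (P Q : M → Measure PathSpace) : Prop := ∃ g : M → ℝ, IsAdmissibleWith P Q g

end

end CircleGibbs

open CircleGibbs

/-!
Dividing the Gibbs law by the claimed density leaves a measure that is recognised as Brownian
motion from its Fourier coefficients; no uniqueness theorem for martingale problems, stochastic
integral or Girsanov theorem enters.

Let `Q` solve the martingale problem for `𝓛_V`. If `h` is an eigenfunction of `L`, `L h = -κ h`,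
then by definition of the ground-state transform `𝓛_V (h / F) = -(lam - V + κ) (h / F)`
(`genGibbs_div`). A function `f` with `𝓛_V f = -c f` makes `f(X_t) exp(∫₀ᵗ c(X_r) dr)` a
`Q`-martingale (`integral_feynmanKac_smul`): integrated against a bounded variable known at time
`s`, this process has right derivative zero in `t ≥ s`, because `f(X)` has drift `-c f(X)` and the
exponential has the opposite logarithmic derivative.

With `h = 1` this says that `F(X_t)⁻¹ exp(∫₀ᵗ (lam - V)(X_r) dr)`, which is the inverse of the
density up to the factor `F(X_0)`, is a `Q`-martingale. With `h` the real and imaginary parts of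
the character `fourier m`, where `κ = 2π²m²`, it says that under `Q` weighted by the inverse density
the conditional mean of `fourier m (X_t)` given `𝓕_s` is `exp(-2π²m²(t - s)) fourier m (X_s)`. Hence
the joint Fourier coefficients of the increments of the weighted measure are those of Brownian
motion (`IsGibbsLaw.hasHeatIncrements_withDensity` and `IsBrownianLaw.hasHeatIncrements`). Trigonometric
polynomials are dense in the continuous functions on a torus, so the starting point and these
coefficients determine a path measure on `𝓕_T` (`HasHeatIncrements.trim_eq`). The weighted measure
is therefore the Brownian law on `𝓕_T`, and multiplying back by the density gives the first claim.

For `g = log F` the eigenvalue equation reads `½ (g'' + g'²) = lam - V` (`circleDeriv_log`), which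
turns the density into the form required for admissibility.
-/

open Filter Topology

namespace CircleGibbs

/-! ### Measurability and time integrals along paths -/

theorem measurable_intervalIntegral_of_continuous {Ω : Type*} [MeasurableSpace Ω]
    {Y : ℝ → Ω → ℝ} (hc : ∀ ω, Continuous fun r => Y r ω) (hm : ∀ r, Measurable (Y r)) (a b : ℝ) :
    Measurable fun ω => ∫ r in a..b, Y r ω := by
  have h := stronglyMeasurable_uncurry_of_continuous_of_stronglyMeasurable hc
    (fun r => (hm r).stronglyMeasurable)
  have h' : StronglyMeasurable (fun p : Ω × ℝ => Y p.2 p.1) := h.comp_measurable measurable_swap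
  simp only [intervalIntegral]
  exact (h'.integral_prod_right' (ν := volume.restrict (Set.Ioc a b))).measurable.sub
    (h'.integral_prod_right' (ν := volume.restrict (Set.Ioc b a))).measurable

theorem measurable_coord_of_le {s t : ℝ≥0} (h : s ≤ t) :
    Measurable[canonicalFiltration t] (coord s) := by
  refine Measurable.mono ?_ (canonicalFiltration.mono h) le_rfl
  exact ((Filtration.stronglyAdapted_natural
    fun t => (measurable_coord t).stronglyMeasurable) s).measurable

theorem continuous_comp_coord {φ : M → ℝ} (hφ : Continuous φ) (w : PathSpace) :
    Continuous fun r : ℝ => φ (coord r.toNNReal w) :=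
  hφ.comp (w.2.comp continuous_real_toNNReal)

theorem measurable_pathIntegral {φ : M → ℝ} (hφ : Continuous φ) (t : ℝ≥0) :
    Measurable[canonicalFiltration t] (pathIntegral φ t) := by
  -- Stopping the integrand at time `t` makes it `𝓕_t`-measurable and leaves the integral unchanged.
  have key : pathIntegral φ t =
      fun w => ∫ r in (0 : ℝ)..(t : ℝ), φ (coord (min r t).toNNReal w) := by
    funext w
    refine intervalIntegral.integral_congr fun r hr => ?_
    rw [Set.uIcc_of_le (NNReal.coe_nonneg t)] at hr
    simp only [min_eq_left hr.2]
  rw [key]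
  refine @measurable_intervalIntegral_of_continuous _ (canonicalFiltration t) _
    (fun w => ?_) (fun r => ?_) _ _
  · exact (continuous_comp_coord hφ w).comp (continuous_id.min continuous_const)
  · refine hφ.measurable.comp (measurable_coord_of_le ?_)
    exact Real.toNNReal_le_iff_le_coe.2 (min_le_right _ _)

/-- A martingale keeps its mean after multiplication by a bounded variable known at the earlier
time. -/
theorem integral_martingale_smul {Ω : Type*} {m0 : MeasurableSpace Ω} {μ : Measure Ω}
    [IsFiniteMeasure μ] {𝓕 : Filtration ℝ≥0 m0} {N : ℝ≥0 → Ω → ℝ} (hN : Martingale N 𝓕 μ)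
    {s t : ℝ≥0} (hst : s ≤ t) {H : Ω → ℂ} (hH : StronglyMeasurable[𝓕 s] H) {C : ℝ}
    (hC : ∀ ω, ‖H ω‖ ≤ C) :
    ∫ ω, N t ω • H ω ∂μ = ∫ ω, N s ω • H ω ∂μ := by
  have hHm : AEStronglyMeasurable H μ := (hH.mono (𝓕.le s)).aestronglyMeasurable
  have hint : Integrable (fun ω => N t ω • H ω) μ :=
    (hN.integrable t).smul_bdd C hHm (.of_forall hC)
  have h := condExp_bilin_of_stronglyMeasurable_left (μ := μ) (m := 𝓕 s)
    (ContinuousLinearMap.lsmul ℝ ℝ : ℝ →L[ℝ] ℂ →L[ℝ] ℂ).flip hH (g := N t) hint (hN.integrable t)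
  rw [← integral_condExp (𝓕.le s)]
  refine integral_congr_ae ?_
  filter_upwards [h, hN.condExp_ae_eq hst] with ω h1 h2
  simpa [h2] using h1

theorem pathIntegral_sub {φ : M → ℝ} (hφ : Continuous φ) (s t : ℝ≥0) (w : PathSpace) :
    pathIntegral φ t w - pathIntegral φ s w = ∫ r in (s : ℝ)..t, φ (coord r.toNNReal w) :=
  intervalIntegral.integral_interval_sub_left ((continuous_comp_coord hφ w).intervalIntegrable _ _)
    ((continuous_comp_coord hφ w).intervalIntegrable _ _)

/-! ### The Feynman–Kac martingale -/

/-- The Feynman–Kac process `f(X_t) exp(∫₀ᵗ c(X_r) dr)`, at a real time `t`. -/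
noncomputable def feynmanKac (f c : M → ℝ) (t : ℝ) (w : PathSpace) : ℝ :=
  f (coord t.toNNReal w) * Real.exp (∫ r in (0 : ℝ)..t, c (coord r.toNNReal w))

theorem feynmanKac_coe (f c : M → ℝ) (t : ℝ≥0) (w : PathSpace) :
    feynmanKac f c t w = f (coord t w) * Real.exp (pathIntegral c t w) := by
  simp [feynmanKac, pathIntegral]

theorem measurable_feynmanKac {f c : M → ℝ} (hf : Continuous f) (hc : Continuous c) (t : ℝ≥0) :
    Measurable[canonicalFiltration t] (feynmanKac f c t) := by
  have : feynmanKac f c t = fun w => f (coord t w) * Real.exp (pathIntegral c t w) :=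
    funext (feynmanKac_coe f c t)
  rw [this]
  exact (hf.measurable.comp (measurable_coord_of_le le_rfl)).mul
    (Real.measurable_exp.comp (measurable_pathIntegral hc t))

theorem abs_integral_coord_le {c : M → ℝ} {C : ℝ} (hC : ∀ y, |c y| ≤ C) (s t : ℝ)
    (w : PathSpace) : |∫ r in s..t, c (coord r.toNNReal w)| ≤ C * |t - s| := by
  simpa using intervalIntegral.norm_integral_le_of_norm_le_const
    (f := fun r : ℝ => c (coord r.toNNReal w)) (a := s) (b := t) fun r _ => hC _

theorem exp_integral_coord_le {c : M → ℝ} {C : ℝ} (hC : ∀ y, |c y| ≤ C) {t b : ℝ} (ht : 0 ≤ t)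
    (htb : t ≤ b) (w : PathSpace) :
    Real.exp (∫ r in (0 : ℝ)..t, c (coord r.toNNReal w)) ≤ Real.exp (C * b) := by
  have hC0 : 0 ≤ C := (abs_nonneg _).trans (hC 0)
  refine Real.exp_le_exp.2 ((le_abs_self _).trans ((abs_integral_coord_le hC 0 t w).trans ?_))
  rw [sub_zero, abs_of_nonneg ht]
  gcongr

theorem exists_abs_le_of_continuous {f : M → ℝ} (hf : Continuous f) : ∃ C, ∀ y, |f y| ≤ C := by
  obtain ⟨C, hC⟩ := isCompact_univ.exists_bound_of_continuousOn hf.continuousOn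
  exact ⟨C, fun y => hC y trivial⟩

theorem hasDerivAt_integral_coord {c : M → ℝ} (hc : Continuous c) (a t : ℝ) (w : PathSpace) :
    HasDerivAt (fun u => ∫ r in a..u, c (coord r.toNNReal w)) (c (coord t.toNNReal w)) t :=
  intervalIntegral.integral_hasDerivAt_right
    ((continuous_comp_coord hc w).intervalIntegrable _ _)
    ((continuous_comp_coord hc w).stronglyMeasurableAtFilter _ _)
    (continuous_comp_coord hc w).continuousAt

theorem continuous_feynmanKac {f c : M → ℝ} (hf : Continuous f) (hc : Continuous c)
    (w : PathSpace) : Continuous fun t => feynmanKac f c t w :=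
  (continuous_comp_coord hf w).mul (Real.continuous_exp.comp
    (continuous_iff_continuousAt.2 fun t => (hasDerivAt_integral_coord hc 0 t w).continuousAt))

theorem abs_feynmanKac_le {f c : M → ℝ} {K C : ℝ} (hK : ∀ y, |f y| ≤ K) (hC : ∀ y, |c y| ≤ C)
    {t b : ℝ} (ht : 0 ≤ t) (htb : t ≤ b) (w : PathSpace) :
    |feynmanKac f c t w| ≤ K * Real.exp (C * b) := by
  rw [feynmanKac, abs_mul, Real.abs_exp]
  exact mul_le_mul (hK _) (exp_integral_coord_le hC ht htb w) (Real.exp_pos _).le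
    ((abs_nonneg _).trans (hK 0))

theorem abs_exp_integral_coord_sub_le {c : M → ℝ} (hc : Continuous c) {C : ℝ}
    (hC : ∀ y, |c y| ≤ C) {t u b : ℝ} (ht : 0 ≤ t) (htu : t ≤ u) (hub : u ≤ b) (w : PathSpace) :
    |Real.exp (∫ r in (0 : ℝ)..u, c (coord r.toNNReal w)) -
        Real.exp (∫ r in (0 : ℝ)..t, c (coord r.toNNReal w))| ≤
      Real.exp (C * b) * C * (u - t) := by
  have h := (convex_Icc 0 b).norm_image_sub_le_of_norm_hasDerivWithin_le (C := Real.exp (C * b) * C)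
    (f := fun u => Real.exp (∫ r in (0 : ℝ)..u, c (coord r.toNNReal w)))
    (fun r _ => (hasDerivAt_integral_coord hc 0 r w).exp.hasDerivWithinAt)
    (fun r hr => ?_) (x := t) (y := u) ⟨ht, htu.trans hub⟩ ⟨ht.trans htu, hub⟩
  · simpa [Real.norm_eq_abs, abs_of_nonneg (sub_nonneg.2 htu)] using h
  · rw [Real.norm_eq_abs, abs_mul, Real.abs_exp]
    exact mul_le_mul (exp_integral_coord_le hC hr.1 hr.2 w) (hC _) (abs_nonneg _)
      (Real.exp_pos _).le

/-- The increment of `f(X) exp(∫ c(X))` over `[t, u]` after removing the martingale part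
`A_t (N_u - N_t)`, where `A_t = exp(∫₀ᵗ c(X_r) dr)` and `N` is the martingale attached to `f`. -/
noncomputable def feynmanKacRemainder (f c : M → ℝ) (t u : ℝ) (w : PathSpace) : ℝ :=
  f (coord u.toNNReal w) * (Real.exp (∫ r in (0 : ℝ)..u, c (coord r.toNNReal w)) -
      Real.exp (∫ r in (0 : ℝ)..t, c (coord r.toNNReal w))) -
    Real.exp (∫ r in (0 : ℝ)..t, c (coord r.toNNReal w)) *
      ∫ r in t..u, c (coord r.toNNReal w) * f (coord r.toNNReal w)

/-- The two terms of the remainder cancel to first order: `d(A f(X)) - A df(X) = A c(X) f(X) dt`. -/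
theorem tendsto_feynmanKacRemainder {f c : M → ℝ} (hf : Continuous f) (hc : Continuous c)
    (t : ℝ) (w : PathSpace) :
    Tendsto (fun u => (u - t)⁻¹ * feynmanKacRemainder f c t u w) (𝓝[>] t) (𝓝 0) := by
  have hA := hasDerivAt_iff_tendsto_slope.1 (hasDerivAt_integral_coord hc 0 t w).exp
  have hI := hasDerivAt_iff_tendsto_slope.1 (hasDerivAt_integral_coord (hc.mul hf) t t w)
  have hle : 𝓝[>] t ≤ 𝓝[≠] t := nhdsWithin_mono _ fun u hu => ne_of_gt hu
  have hft : Tendsto (fun u : ℝ => f (coord u.toNNReal w)) (𝓝[>] t)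
      (𝓝 (f (coord t.toNNReal w))) :=
    ((continuous_comp_coord hf w).tendsto t).mono_left nhdsWithin_le_nhds
  have h := (hft.mul (hA.mono_left hle)).sub ((hI.mono_left hle).const_mul
    (Real.exp (∫ r in (0 : ℝ)..t, c (coord r.toNNReal w))))
  convert h using 2 with u
  · simp only [slope, feynmanKacRemainder, vsub_eq_sub, smul_eq_mul,
      intervalIntegral.integral_same, sub_zero, Pi.mul_apply]
    ring
  · simp only [Pi.mul_apply]
    ring

theorem abs_feynmanKacRemainder_le {f c : M → ℝ} (hc : Continuous c)
    {K C : ℝ} (hK : ∀ y, |f y| ≤ K) (hC : ∀ y, |c y| ≤ C) {t u b : ℝ} (ht : 0 ≤ t)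
    (htu : t ≤ u) (hub : u ≤ b) (w : PathSpace) :
    |feynmanKacRemainder f c t u w| ≤ 2 * (K * (Real.exp (C * b) * C)) * (u - t) := by
  have hK0 : 0 ≤ K := (abs_nonneg _).trans (hK 0)
  have hC0 : 0 ≤ C := (abs_nonneg _).trans (hC 0)
  have hI := abs_integral_coord_le (c := fun y => c y * f y) (C := C * K)
    (fun y => (abs_mul _ _).trans_le (mul_le_mul (hC y) (hK y) (abs_nonneg _) hC0)) t u w
  rw [abs_of_nonneg (sub_nonneg.2 htu)] at hI
  have hA := abs_exp_integral_coord_sub_le hc hC ht htu hub w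
  have h1 := mul_le_mul (hK (coord u.toNNReal w)) hA (abs_nonneg _) hK0
  have h2 := mul_le_mul (exp_integral_coord_le hC ht (htu.trans hub) w) hI (abs_nonneg _)
    (Real.exp_pos _).le
  rw [feynmanKacRemainder]
  refine (abs_sub _ _).trans ?_
  rw [abs_mul, abs_mul, Real.abs_exp]
  refine (add_le_add h1 h2).trans_eq ?_
  ring

theorem measurable_feynmanKacRemainder {f c : M → ℝ} (hf : Continuous f) (hc : Continuous c)
    (t u : ℝ) : Measurable (feynmanKacRemainder f c t u) := by
  have hm {φ : M → ℝ} (hφ : Continuous φ) (a b : ℝ) :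
      Measurable fun w : PathSpace => ∫ r in a..b, φ (coord r.toNNReal w) :=
    measurable_intervalIntegral_of_continuous (fun w => continuous_comp_coord hφ w)
      (fun r => hφ.measurable.comp (measurable_coord _)) a b
  exact ((hf.measurable.comp (measurable_coord _)).mul ((hm hc 0 u).exp.sub (hm hc 0 t).exp)).sub
    ((hm hc 0 t).exp.mul (hm (hc.mul hf) t u))

section Martingale

variable {Q : Measure PathSpace} [IsFiniteMeasure Q]

theorem integrable_feynmanKac_smul {f c : M → ℝ} (hf : Continuous f) (hc : Continuous c)
    {H : PathSpace → ℂ} (hH : AEStronglyMeasurable H Q) {B : ℝ} (hB : ∀ w, ‖H w‖ ≤ B) (t : ℝ≥0) :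
    Integrable (fun w => feynmanKac f c t w • H w) Q := by
  obtain ⟨K, hK⟩ := exists_abs_le_of_continuous hf
  obtain ⟨C, hC⟩ := exists_abs_le_of_continuous hc
  have hm : AEStronglyMeasurable (feynmanKac f c t) Q :=
    ((measurable_feynmanKac hf hc t).mono (canonicalFiltration.le t) le_rfl).aestronglyMeasurable
  have hi : Integrable (feynmanKac f c t) Q :=
    Integrable.of_bound hm _ (.of_forall fun w => abs_feynmanKac_le hK hC t.2 le_rfl w)
  exact hi.smul_bdd B hH (.of_forall hB)

theorem integral_feynmanKac_sub {f c : M → ℝ} (hf : Continuous f) (hc : Continuous c)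
    (hN : Martingale (fun (t : ℝ≥0) w => f (coord t w) - f (coord 0 w) -
      pathIntegral (fun y => -(c y * f y)) t w) canonicalFiltration Q)
    {s t u : ℝ≥0} (hst : s ≤ t) (htu : t ≤ u) {H : PathSpace → ℂ}
    (hH : StronglyMeasurable[canonicalFiltration s] H) {B : ℝ} (hB : ∀ w, ‖H w‖ ≤ B) :
    (∫ w, feynmanKac f c u w • H w ∂Q) - ∫ w, feynmanKac f c t w • H w ∂Q =
      ∫ w, feynmanKacRemainder f c t u w • H w ∂Q := by
  obtain ⟨C, hC⟩ := exists_abs_le_of_continuous hc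
  have hHm : AEStronglyMeasurable H Q := (hH.mono (canonicalFiltration.le s)).aestronglyMeasurable
  set A : PathSpace → ℂ := fun w => Real.exp (pathIntegral c t w) • H w with hA
  have hAm : StronglyMeasurable[canonicalFiltration t] A :=
    (Real.measurable_exp.comp (measurable_pathIntegral hc t)).stronglyMeasurable.smul
      (hH.mono (canonicalFiltration.mono hst))
  have hAb : ∀ w, ‖A w‖ ≤ Real.exp (C * t) * B := fun w => by
    rw [hA, norm_smul, Real.norm_eq_abs, Real.abs_exp]
    exact mul_le_mul (exp_integral_coord_le hC t.2 le_rfl w) (hB w) (norm_nonneg _)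
      (Real.exp_pos _).le
  have hAae := (hAm.mono (canonicalFiltration.le t)).aestronglyMeasurable (μ := Q)
  -- `A (N_u - N_t)` has mean zero, so it may be subtracted from the increment.
  have hmart := integral_martingale_smul hN htu hAm hAb
  have hi (v : ℝ≥0) : Integrable (fun w => (f (coord v w) - f (coord 0 w) -
      pathIntegral (fun y => -(c y * f y)) v w) • A w) Q :=
    (hN.integrable v).smul_bdd _ hAae (.of_forall hAb)
  have hj1 := integrable_feynmanKac_smul hf hc hHm hB u
  have hj2 := integrable_feynmanKac_smul hf hc hHm hB t
  rw [← sub_eq_zero, ← integral_sub (hi u) (hi t)] at hmart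
  rw [← integral_sub hj1 hj2, ← sub_zero (∫ w, _ - _ ∂Q), ← hmart]
  refine (integral_sub (hj1.sub hj2) ((hi u).sub (hi t))).symm.trans ?_
  refine integral_congr_ae (.of_forall fun w => ?_)
  have hps := pathIntegral_sub (hc.mul hf).neg t u w
  have hps' : pathIntegral (fun y => -(c y * f y)) u w =
      pathIntegral (fun y => -(c y * f y)) t w -
        ∫ r in (t : ℝ)..u, c (coord r.toNNReal w) * f (coord r.toNNReal w) := by
    rw [sub_eq_add_neg, ← intervalIntegral.integral_neg]
    exact sub_eq_iff_eq_add'.1 hps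
  simp only [Pi.sub_apply, feynmanKac_coe, feynmanKacRemainder, hA, hps', Real.toNNReal_coe,
    ← smul_assoc, ← sub_smul, smul_eq_mul]
  simp only [pathIntegral]
  congr 1
  ring

/-- If `f` solves `𝓛 f = -c f` for a generator `𝓛` whose martingale problem `Q` solves, then
`f(X_t) exp(∫₀ᵗ c(X_r) dr)` is a `Q`-martingale: its mean against a bounded `𝓕_s`-measurable
variable has right derivative zero on `[s, ∞)`. -/
theorem integral_feynmanKac_smul {f c : M → ℝ} (hf : Continuous f) (hc : Continuous c)
    (hN : Martingale (fun (t : ℝ≥0) w => f (coord t w) - f (coord 0 w) -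
      pathIntegral (fun y => -(c y * f y)) t w) canonicalFiltration Q)
    {s t : ℝ≥0} (hst : s ≤ t) {H : PathSpace → ℂ}
    (hH : StronglyMeasurable[canonicalFiltration s] H) {B : ℝ} (hB : ∀ w, ‖H w‖ ≤ B) :
    ∫ w, feynmanKac f c t w • H w ∂Q = ∫ w, feynmanKac f c s w • H w ∂Q := by
  obtain ⟨K, hK⟩ := exists_abs_le_of_continuous hf
  obtain ⟨C, hC⟩ := exists_abs_le_of_continuous hc
  have hK0 : 0 ≤ K := (abs_nonneg _).trans (hK 0)
  have hC0 : 0 ≤ C := (abs_nonneg _).trans (hC 0)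
  have hHm : AEStronglyMeasurable H Q := (hH.mono (canonicalFiltration.le s)).aestronglyMeasurable
  refine constant_of_has_deriv_right_zero (a := (s : ℝ)) (b := t)
    (f := fun u : ℝ => ∫ w, feynmanKac f c u w • H w ∂Q) ?_ ?_ t ⟨hst, le_rfl⟩
  · refine continuousOn_of_dominated (bound := fun _ => K * Real.exp (C * t) * B)
      (fun u hu => ?_) (fun u hu => .of_forall fun w => ?_) (integrable_const _)
      (.of_forall fun w => ?_)
    · lift u to ℝ≥0 using s.2.trans hu.1
      exact (integrable_feynmanKac_smul hf hc hHm hB u).aestronglyMeasurable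
    · rw [norm_smul]
      exact mul_le_mul (abs_feynmanKac_le hK hC (s.2.trans hu.1) hu.2 w) (hB w) (norm_nonneg _)
        (mul_nonneg hK0 (Real.exp_pos _).le)
    · exact ((continuous_feynmanKac hf hc w).smul continuous_const).continuousOn
  · intro r hr
    lift r to ℝ≥0 using s.2.trans hr.1
    rw [hasDerivWithinAt_iff_tendsto_slope,
      Set.Ici_sdiff_left]
    have hslope : ∀ᶠ u in 𝓝[>] (r : ℝ),
        slope (fun u : ℝ => ∫ w, feynmanKac f c u w • H w ∂Q) r u =
          ∫ w, ((u - r)⁻¹ * feynmanKacRemainder f c r u w) • H w ∂Q := by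
      filter_upwards [self_mem_nhdsWithin] with u hu
      lift u to ℝ≥0 using r.2.trans (le_of_lt hu)
      rw [slope, vsub_eq_sub, integral_feynmanKac_sub hf hc hN hr.1 (le_of_lt hu) hH hB,
        ← integral_smul]
      simp only [smul_smul]
    refine Tendsto.congr' (hslope.mono fun _ h => h.symm) ?_
    rw [← integral_zero PathSpace ℂ (μ := Q)]
    refine tendsto_integral_filter_of_dominated_convergence
      (fun _ => 2 * (K * (Real.exp (C * t) * C)) * B) ?_ ?_ (integrable_const _)
      (.of_forall fun w => ?_)
    · filter_upwards [self_mem_nhdsWithin] with u hu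
      lift u to ℝ≥0 using r.2.trans (le_of_lt hu)
      exact ((measurable_feynmanKacRemainder hf hc r u).const_mul _).aestronglyMeasurable.smul hHm
    · filter_upwards [Ioo_mem_nhdsGT hr.2] with u hu
      refine .of_forall fun w => ?_
      have hpos : 0 < u - r := sub_pos.2 hu.1
      rw [norm_smul, Real.norm_eq_abs, abs_mul, abs_inv, abs_of_pos hpos]
      refine mul_le_mul ?_ (hB w) (norm_nonneg _) (by positivity)
      rw [inv_mul_le_iff₀ hpos, mul_comm]
      exact abs_feynmanKacRemainder_le hc hK hC r.2 hu.1.le hu.2.le w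
    · simpa using (tendsto_feynmanKacRemainder hf hc r w).smul_const (H w)

end Martingale

/-! ### Characters determine path measures -/

theorem fourier_add_apply (k : ℤ) (x y : M) :
    fourier k (x + y) = fourier k x * fourier k y := by
  simp [fourier_apply, smul_add, AddCircle.toCircle_add]

/-- A product of characters of the positions at finitely many times is a product of characters of
successive increments, up to characters of the initial position. -/
theorem exists_prod_fourier_coord_eq (k : ℝ≥0 → ℤ) (J : Finset ℝ≥0) :
    ∀ s : ℝ≥0, (∀ j ∈ J, j ≤ s) → ∃ (n : ℕ) (τ : ℕ → ℝ≥0) (m : ℕ → ℤ),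
      Monotone τ ∧ τ 0 = 0 ∧ τ n = s ∧ (∀ i, τ i ≤ s) ∧
      ∀ w : PathSpace, ∏ j ∈ J, fourier (k j) (coord j w) =
        (∏ j ∈ J, fourier (k j) (coord 0 w)) *
          ∏ i ∈ Finset.range n, fourier (m i) (coord (τ (i + 1)) w - coord (τ i) w) := by
  induction J using Finset.induction_on_max with
  | empty =>
    intro s _
    refine ⟨1, fun i => if i = 0 then 0 else s, 0, ?_, by simp, by simp, ?_, by simp⟩
    · intro i j hij
      by_cases hi : i = 0
      · simp [hi]
      · simp [hi, show j ≠ 0 by lia]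
    · intro i
      by_cases hi : i = 0 <;> simp [hi]
  | insert a J hJ ih =>
    intro s hs
    have has : a ≤ s := hs a (Finset.mem_insert_self _ _)
    obtain ⟨n, τ, m, hτ, h0, hn, hle, h⟩ := ih a fun j hj => (hJ j hj).le
    -- The character at the largest time `a` is spread over all increments up to `a`.
    refine ⟨n + 1, fun i => if i ≤ n then τ i else s, fun i => if i < n then m i + k a else 0,
      ?_, by simp [h0], by simp, ?_, fun w => ?_⟩
    · intro i j hij
      by_cases hj : j ≤ n
      · simpa [hj, hij.trans hj] using hτ hij
      · by_cases hi : i ≤ n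
        · simpa [hi, hj] using (hle i).trans has
        · simp [hi, hj]
    · intro i
      by_cases hi : i ≤ n
      · simpa [hi] using (hle i).trans has
      · simp [hi]
    · have htel : ∀ n', fourier (k a) (coord (τ n') w) = fourier (k a) (coord 0 w) *
          ∏ i ∈ Finset.range n', fourier (k a) (coord (τ (i + 1)) w - coord (τ i) w) := by
        intro n'
        induction n' with
        | zero => simp [h0]
        | succ n' ih' =>
          rw [Finset.prod_range_succ, ← mul_assoc, ← ih', ← fourier_add_apply]
          congr 1
          abel
      have hta := htel n
      rw [hn] at hta
      have haJ : a ∉ J := fun ha => lt_irrefl _ (hJ a ha)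
      rw [Finset.prod_insert haJ, Finset.prod_insert haJ, h w, hta,
        Finset.prod_range_succ]
      have hprod : ∏ i ∈ Finset.range n, fourier (if i < n then m i + k a else 0)
            (coord (if i + 1 ≤ n then τ (i + 1) else s) w -
              coord (if i ≤ n then τ i else s) w) =
          (∏ i ∈ Finset.range n, fourier (m i) (coord (τ (i + 1)) w - coord (τ i) w)) *
          ∏ i ∈ Finset.range n, fourier (k a) (coord (τ (i + 1)) w - coord (τ i) w) := by
        rw [← Finset.prod_mul_distrib]
        refine Finset.prod_congr rfl fun i hi => ?_
        have hi' := Finset.mem_range.1 hi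
        simp [hi', Nat.succ_le_of_lt hi', hi'.le]
      rw [hprod]
      simp only [lt_irrefl, if_false, fourier_zero, mul_one]
      ring

/-- The decay rate `2π²m²`: the character `fourier m` is an eigenfunction of `½ ∂²/∂x²` for the
eigenvalue `-2π²m²`. -/
noncomputable def heatRate (m : ℤ) : ℝ := 2 * Real.pi ^ 2 * (m : ℝ) ^ 2

/-- Up to time `T`, the increments of the coordinate process under `P` have the joint Fourier
coefficients of independent centred Gaussian increments modulo `1`. -/
def HasHeatIncrements (T : ℝ≥0) (P : Measure PathSpace) : Prop :=
  ∀ (n : ℕ) (τ : ℕ → ℝ≥0) (m : ℕ → ℤ), Monotone τ → τ 0 = 0 → (∀ i, τ i ≤ T) →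
    ∫ w, ∏ i ∈ Finset.range n, fourier (m i) (coord (τ (i + 1)) w - coord (τ i) w) ∂P =
      ∏ i ∈ Finset.range n, (Real.exp (-heatRate (m i) * (τ (i + 1) - τ i)) : ℂ)

/-- Finite measures on a finite-dimensional torus with the same Fourier coefficients coincide. -/
theorem ext_of_integral_mFourier_eq {d : Type*} [Fintype d] {μ ν : Measure (d → M)}
    [IsFiniteMeasure μ] [IsFiniteMeasure ν]
    (h : ∀ n : d → ℤ, ∫ x, UnitAddTorus.mFourier n x ∂μ = ∫ x, UnitAddTorus.mFourier n x ∂ν) :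
    μ = ν := by
  have hint (ρ : Measure (d → M)) [IsFiniteMeasure ρ] (g : C(UnitAddTorus d, ℂ)) :
      Integrable (fun x => g x) ρ :=
    Integrable.of_bound g.continuous.measurable.aestronglyMeasurable ‖g‖
      (.of_forall g.norm_coe_le_norm)
  have hcont (ρ : Measure (d → M)) [IsFiniteMeasure ρ] :
      Continuous fun g : C(UnitAddTorus d, ℂ) => ∫ x, g x ∂ρ := by
    refine (LipschitzWith.of_dist_le_mul (K := (ρ Set.univ).toNNReal) fun f g => ?_).continuous
    rw [dist_eq_norm, ← integral_sub (hint ρ f) (hint ρ g), dist_eq_norm, mul_comm]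
    exact norm_integral_le_of_norm_le_const (.of_forall (f - g).norm_coe_le_norm)
  have hspan : ∀ g ∈ Submodule.span ℂ (Set.range (UnitAddTorus.mFourier (d := d))),
      ∫ x, g x ∂μ = ∫ x, g x ∂ν := by
    intro g hg
    induction hg using Submodule.span_induction with
    | mem g hg => obtain ⟨n, rfl⟩ := hg; exact h n
    | zero => simp
    | add f g _ _ hf hg =>
      simp only [ContinuousMap.add_apply]
      rw [integral_add (hint μ f) (hint μ g), integral_add (hint ν f) (hint ν g), hf, hg]
    | smul a g _ hg =>
      simp only [ContinuousMap.smul_apply]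
      rw [integral_smul, integral_smul, hg]
  have hall (g : C(UnitAddTorus d, ℂ)) : ∫ x, g x ∂μ = ∫ x, g x ∂ν := by
    have hg : g ∈ (Submodule.span ℂ
        (Set.range (UnitAddTorus.mFourier (d := d)))).topologicalClosure := by
      rw [UnitAddTorus.span_mFourier_closure_eq_top]; trivial
    exact closure_minimal hspan (isClosed_eq (hcont μ) (hcont ν)) hg
  refine ext_of_forall_integral_eq_of_IsFiniteMeasure fun f => ?_
  have hf := hall ⟨fun x => (f x : ℂ), by fun_prop⟩
  simp only [ContinuousMap.coe_mk, integral_complex_ofReal] at hf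
  exact_mod_cast hf

theorem HasHeatIncrements.integral_prod_fourier {T : ℝ≥0} {P : Measure PathSpace}
    (hP : HasHeatIncrements T P) {x : M} (h0 : ∀ᵐ w ∂P, coord 0 w = x) {n : ℕ} {τ : ℕ → ℝ≥0}
    {m : ℕ → ℤ} (hτ : Monotone τ) (hτ0 : τ 0 = 0) (hτT : ∀ i, τ i ≤ T) (J : Finset ℝ≥0)
    (k : ℝ≥0 → ℤ) (h : ∀ w : PathSpace, ∏ j ∈ J, fourier (k j) (coord j w) =
        (∏ j ∈ J, fourier (k j) (coord 0 w)) *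
          ∏ i ∈ Finset.range n, fourier (m i) (coord (τ (i + 1)) w - coord (τ i) w)) :
    ∫ w, ∏ j ∈ J, fourier (k j) (coord j w) ∂P = (∏ j ∈ J, fourier (k j) x) *
      ∏ i ∈ Finset.range n, (Real.exp (-heatRate (m i) * (τ (i + 1) - τ i)) : ℂ) := by
  rw [← hP n τ m hτ hτ0 hτT, ← integral_const_mul]
  refine integral_congr_ae ?_
  filter_upwards [h0] with w hw
  rw [h w, hw]

/-- The starting point and the Fourier coefficients of the increments determine a path measure on
`𝓕_T`. -/
theorem HasHeatIncrements.trim_eq {T : ℝ≥0} {P P' : Measure PathSpace} [IsFiniteMeasure P]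
    [IsFiniteMeasure P'] (hP : HasHeatIncrements T P) (hP' : HasHeatIncrements T P') {x : M}
    (hP0 : ∀ᵐ w ∂P, coord 0 w = x) (hP'0 : ∀ᵐ w ∂P', coord 0 w = x) :
    P.trim (canonicalFiltration.le T) = P'.trim (canonicalFiltration.le T) := by
  set ρ : PathSpace → Set.Iic T → M := fun w j => coord j w with hρ
  have hρm : Measurable ρ := measurable_pi_lambda _ fun j => measurable_coord j
  have hmap : P.map ρ = P'.map ρ := by
    refine IsProjectiveLimit.unique (P := fun J => (P.map ρ).map J.restrict) (fun J => rfl)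
      fun J => ?_
    have hJm : Measurable (J.restrict (π := fun _ : Set.Iic T => M)) :=
      Finset.measurable_restrict J
    refine ext_of_integral_mFourier_eq fun k => ?_
    -- The exponents `k`, indexed by `J`, are extended by zero to all times.
    classical
    set k' : ℝ≥0 → ℤ := fun t =>
      if ht : t ≤ T then (if hj : (⟨t, ht⟩ : Set.Iic T) ∈ J then k ⟨_, hj⟩ else 0) else 0
    have hk (w : PathSpace) : UnitAddTorus.mFourier k (J.restrict (ρ w)) =
        ∏ j ∈ J.map (Function.Embedding.subtype _), fourier (k' j) (coord j w) := by
      rw [Finset.prod_map, ← Finset.prod_coe_sort]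
      refine Finset.prod_congr rfl fun j _ => ?_
      have hj : (j : Set.Iic T).1 ≤ T := (j : Set.Iic T).2
      have hkj : k' (j : Set.Iic T) = k j :=
        (dif_pos hj).trans (dif_pos j.2)
      rw [Function.Embedding.subtype_apply, hkj, hρ, Finset.restrict]
    have hint (S : Measure PathSpace) :
        ∫ y, UnitAddTorus.mFourier k y ∂((S.map ρ).map J.restrict) =
          ∫ w, ∏ j ∈ J.map (Function.Embedding.subtype _), fourier (k' j) (coord j w) ∂S := by
      have hc := (UnitAddTorus.mFourier k).continuous.measurable.stronglyMeasurable
      rw [Measure.map_map hJm hρm, integral_map (hJm.comp hρm).aemeasurable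
        hc.aestronglyMeasurable]
      simp only [Function.comp_apply, hk]
    obtain ⟨n, τ, m, hτ, h0, -, hle, h⟩ := exists_prod_fourier_coord_eq k'
      (J.map (Function.Embedding.subtype _)) T (by simp +contextual)
    rw [hint, hint, hP.integral_prod_fourier hP0 hτ h0 hle _ _ h,
      hP'.integral_prod_fourier hP'0 hτ h0 hle _ _ h]
  refine @Measure.ext _ (canonicalFiltration T) _ _ fun s hs => ?_
  rw [trim_measurableSet_eq _ hs, trim_measurableSet_eq _ hs]
  have hs' := hs
  rw [canonicalFiltration, Filtration.natural_eq_comap] at hs'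
  obtain ⟨S, hS, rfl⟩ := hs'
  have := congrArg (fun μ => μ S) hmap
  simpa only [Measure.map_apply hρm hS] using this

/-! ### Fourier coefficients of Brownian increments -/

theorem integral_fourier_gaussianReal (m : ℤ) (v : ℝ≥0) :
    ∫ y : M, fourier m y ∂((gaussianReal 0 v).map fun y : ℝ => (y : M)) =
      (Real.exp (-heatRate m * v) : ℂ) := by
  rw [integral_map (AddCircle.measurable_mk').aemeasurable
    (fourier m).continuous.measurable.aestronglyMeasurable]
  have h := charFun_gaussianReal (μ := 0) (v := v) (2 * Real.pi * m)
  rw [charFun_apply_real] at h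
  convert h using 1
  · refine integral_congr_ae (.of_forall fun y => ?_)
    simp only [fourier_coe_apply]
    congr 1
    push_cast
    ring
  · push_cast [heatRate]
    congr 1
    ring

theorem IsBrownianLaw.hasHeatIncrements {x : M} {P : Measure PathSpace} (hP : IsBrownianLaw x P)
    (T : ℝ≥0) : HasHeatIncrements T P := by
  intro n τ m hτ _ _
  have h1 := hP.indep.nat hτ
  have hm (i : ℕ) : Measurable fun w : PathSpace => coord (τ (i + 1)) w - coord (τ i) w :=
    (measurable_coord _).sub (measurable_coord _)
  have h2 : iIndepFun (fun (i : Fin n) (w : PathSpace) =>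
      fourier (m i) (coord (τ (i + 1)) w - coord (τ i) w)) P :=
    (h1.precomp (g := fun i : Fin n => (i : ℕ)) Fin.val_injective).comp
      (fun i => fourier (m i)) fun i => (fourier (m i)).continuous.measurable
  simp only [Finset.prod_range]
  rw [h2.integral_fun_prod_eq_prod_integral fun i =>
    ((fourier (m i)).continuous.measurable.comp (hm i)).aestronglyMeasurable]
  refine Finset.prod_congr rfl fun i _ => ?_
  have hle : τ i ≤ τ (i + 1) := hτ (Nat.le_succ _)
  have h3 := integral_fourier_gaussianReal (m i) (τ (i + 1) - τ i)
  rw [← hP.increment _ _ hle, integral_map (hm i).aemeasurable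
    (fourier (m i)).continuous.measurable.aestronglyMeasurable, NNReal.coe_sub hle] at h3
  exact_mod_cast h3

/-! ### Calculus on the circle -/

theorem IsC2.continuous {f : M → ℝ} (hf : IsC2 f) : Continuous f :=
  QuotientAddGroup.isOpenQuotientMap_mk.isQuotientMap.continuous_iff.2 (ContDiff.continuous hf)

theorem circleDeriv_coe (f : M → ℝ) (y : ℝ) :
    circleDeriv f (y : M) = deriv (fun z : ℝ => f (z : M)) y := by
  have h := deriv_comp_const_add (fun z : ℝ => f (z : M)) y 0
  rw [add_zero] at h
  rw [circleDeriv, ← h]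
  simp

theorem circleDeriv_const_mul (a : ℝ) (f : M → ℝ) :
    circleDeriv (fun y => a * f y) = fun y => a * circleDeriv f y :=
  funext fun x => deriv_const_mul_field (v := fun h : ℝ => f (x + (h : M))) a

theorem norm_fourier_apply (m : ℤ) (y : M) : ‖fourier m y‖ = 1 := by
  rw [fourier_apply, Circle.norm_coe]

theorem fourier_re_coe (m : ℤ) (y : ℝ) :
    (fourier m (y : M)).re = Real.cos (2 * Real.pi * m * y) := by
  rw [fourier_coe_apply, show (2 * Real.pi * Complex.I * m * y / (1 : ℝ) : ℂ) =
    ((2 * Real.pi * m * y : ℝ) : ℂ) * Complex.I by push_cast; ring, Complex.exp_ofReal_mul_I_re]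

theorem fourier_im_coe (m : ℤ) (y : ℝ) :
    (fourier m (y : M)).im = Real.sin (2 * Real.pi * m * y) := by
  rw [fourier_coe_apply, show (2 * Real.pi * Complex.I * m * y / (1 : ℝ) : ℂ) =
    ((2 * Real.pi * m * y : ℝ) : ℂ) * Complex.I by push_cast; ring, Complex.exp_ofReal_mul_I_im]

theorem isC2_fourier_re (m : ℤ) : IsC2 fun y => (fourier m y).re := by
  simp only [IsC2, fourier_re_coe]
  fun_prop

theorem isC2_fourier_im (m : ℤ) : IsC2 fun y => (fourier m y).im := by
  simp only [IsC2, fourier_im_coe]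
  fun_prop

theorem circleDeriv_fourier_re (m : ℤ) :
    circleDeriv (fun y => (fourier m y).re) = fun y => -(2 * Real.pi * m) * (fourier m y).im := by
  funext x
  induction x using QuotientAddGroup.induction_on with | H y
  rw [circleDeriv_coe, fourier_im_coe]
  simp only [fourier_re_coe]
  have h := ((hasDerivAt_id y).const_mul (2 * Real.pi * m)).cos.deriv
  simp only [id, mul_one] at h
  rw [h]
  ring

theorem circleDeriv_fourier_im (m : ℤ) :
    circleDeriv (fun y => (fourier m y).im) = fun y => 2 * Real.pi * m * (fourier m y).re := by
  funext x
  induction x using QuotientAddGroup.induction_on with | H y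
  rw [circleDeriv_coe, fourier_re_coe]
  simp only [fourier_im_coe]
  have h := ((hasDerivAt_id y).const_mul (2 * Real.pi * m)).sin.deriv
  simp only [id, mul_one] at h
  rw [h]
  ring

theorem genL_fourier_re (m : ℤ) (x : M) :
    genL (fun y => (fourier m y).re) x = -heatRate m * (fourier m x).re := by
  rw [genL, circleDeriv_fourier_re, circleDeriv_const_mul, circleDeriv_fourier_im, heatRate]
  ring

theorem genL_fourier_im (m : ℤ) (x : M) :
    genL (fun y => (fourier m y).im) x = -heatRate m * (fourier m x).im := by
  rw [genL, circleDeriv_fourier_im, circleDeriv_const_mul, circleDeriv_fourier_re, heatRate]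
  ring

/-! ### The Gibbs law -/

section Gibbs

variable {V : M → ℝ} {lam : ℝ} {F : M → ℝ} {x : M} {Q : Measure PathSpace}

/-- The ground-state transform intertwines `𝓛_V` with `L`: if `L h = -κ h` then
`𝓛_V (h / F) = -(lam - V + κ) (h / F)`. -/
theorem genGibbs_div (hpos : ∀ x, 0 < F x) {h : M → ℝ} {κ : ℝ} (hh : ∀ x, genL h x = -κ * h x) :
    genGibbs V lam F (fun y => h y / F y) =
      fun y => -((lam - V y + κ) * (h y / F y)) := by
  funext y
  have hFh : (fun y => F y * (h y / F y)) = h := funext fun y => mul_div_cancel₀ _ (hpos y).ne'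
  rw [genGibbs, hFh, schrodinger, hh]
  ring

/-- For an eigenfunction `h` of `L` with eigenvalue `-κ`, the process
`(h / F)(X_t) exp(∫₀ᵗ (lam - V + κ)(X_r) dr)` is a martingale under the Gibbs law. -/
theorem IsGibbsLaw.integral_feynmanKac_smul (hQ : IsGibbsLaw V lam F x Q) (hV : Continuous V)
    (hF : IsC2 F) (hpos : ∀ x, 0 < F x) {h : M → ℝ} (hC : IsC2 h) {κ : ℝ}
    (hh : ∀ x, genL h x = -κ * h x) {s t : ℝ≥0} (hst : s ≤ t) {H : PathSpace → ℂ}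
    (hH : StronglyMeasurable[canonicalFiltration s] H) {B : ℝ} (hB : ∀ w, ‖H w‖ ≤ B) :
    ∫ w, feynmanKac (fun y => h y / F y) (fun y => lam - V y + κ) t w • H w ∂Q =
      ∫ w, feynmanKac (fun y => h y / F y) (fun y => lam - V y + κ) s w • H w ∂Q := by
  have := hQ.isProbabilityMeasure
  have hmart := hQ.martingale (fun y => h y / F y) (ContDiff.div hC hF fun y => (hpos y).ne')
  rw [genGibbs_div hpos hh] at hmart
  exact CircleGibbs.integral_feynmanKac_smul
    (hC.continuous.div hF.continuous fun y => (hpos y).ne') (by fun_prop) hmart hst hH hB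

/-- Adding a constant to the potential factors out of the exponential. -/
theorem feynmanKac_div_add_const (hV : Continuous V) (h : M → ℝ) (κ : ℝ) (t : ℝ≥0)
    (w : PathSpace) :
    feynmanKac (fun y => h y / F y) (fun y => lam - V y + κ) t w =
      Real.exp (κ * t) * (feynmanKac (fun y => 1 / F y) (fun y => lam - V y) t w *
        h (coord t w)) := by
  have hc : Continuous fun y => lam - V y := by fun_prop
  have hadd : pathIntegral (fun y => lam - V y + κ) t w =
      pathIntegral (fun y => lam - V y) t w + κ * t := by
    simp only [pathIntegral]
    rw [intervalIntegral.integral_add ((continuous_comp_coord hc w).intervalIntegrable _ _)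
      intervalIntegrable_const, intervalIntegral.integral_const]
    simp [mul_comm]
  rw [feynmanKac_coe, feynmanKac_coe, hadd, Real.exp_add]
  ring

/-- Under the Gibbs law weighted by `F(X_t)⁻¹ exp(∫₀ᵗ (lam - V)(X_r) dr)`, the characters of the
position decay as under the heat semigroup. -/
theorem IsGibbsLaw.integral_feynmanKac_smul_fourier (hQ : IsGibbsLaw V lam F x Q)
    (hV : Continuous V) (hF : IsC2 F) (hpos : ∀ x, 0 < F x) (m : ℤ) {s t : ℝ≥0} (hst : s ≤ t)
    {H : PathSpace → ℂ} (hH : StronglyMeasurable[canonicalFiltration s] H) {B : ℝ}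
    (hB : ∀ w, ‖H w‖ ≤ B) :
    ∫ w, feynmanKac (fun y => 1 / F y) (fun y => lam - V y) t w •
        (H w * fourier m (coord t w)) ∂Q =
      (Real.exp (-heatRate m * (t - s)) : ℂ) *
        ∫ w, feynmanKac (fun y => 1 / F y) (fun y => lam - V y) s w •
          (H w * fourier m (coord s w)) ∂Q := by
  have := hQ.isProbabilityMeasure
  have hHm : AEStronglyMeasurable H Q := (hH.mono (canonicalFiltration.le s)).aestronglyMeasurable
  have hre := hQ.integral_feynmanKac_smul hV hF hpos (isC2_fourier_re m) (genL_fourier_re m)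
    hst hH hB
  have him := hQ.integral_feynmanKac_smul hV hF hpos (isC2_fourier_im m) (genL_fourier_im m)
    hst hH hB
  have hc : Continuous fun y => lam - V y + heatRate m := by fun_prop
  have hcont {h : M → ℝ} (hC : IsC2 h) : Continuous fun y => h y / F y :=
    hC.continuous.div hF.continuous fun y => (hpos y).ne'
  have key (u : ℝ≥0) :
      (∫ w, feynmanKac (fun y => (fourier m y).re / F y) (fun y => lam - V y + heatRate m) u w •
        H w ∂Q) + Complex.I * ∫ w, feynmanKac (fun y => (fourier m y).im / F y)
          (fun y => lam - V y + heatRate m) u w • H w ∂Q =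
      (Real.exp (heatRate m * u) : ℂ) *
        ∫ w, feynmanKac (fun y => 1 / F y) (fun y => lam - V y) u w •
          (H w * fourier m (coord u w)) ∂Q := by
    have i1 := integrable_feynmanKac_smul (hcont (isC2_fourier_re m)) hc hHm hB u
    have i2 := integrable_feynmanKac_smul (hcont (isC2_fourier_im m)) hc hHm hB u
    rw [← integral_const_mul, ← integral_const_mul, ← integral_add i1 (i2.const_mul _)]
    refine integral_congr_ae (.of_forall fun w => ?_)
    simp only [feynmanKac_div_add_const hV (fun y => (fourier m y).re),
      feynmanKac_div_add_const hV (fun y => (fourier m y).im), Complex.real_smul]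
    conv_rhs => rw [← Complex.re_add_im (fourier m (coord u w))]
    push_cast
    ring
  have h := key t
  rw [hre, him, key s] at h
  have hexp : (Real.exp (-heatRate m * (t - s)) : ℂ) =
      (Real.exp (heatRate m * s) : ℂ) / (Real.exp (heatRate m * t) : ℂ) := by
    rw [← Complex.ofReal_div, ← Real.exp_sub]
    congr 2
    ring
  have hne : (Real.exp (heatRate m * t) : ℂ) ≠ 0 := Complex.ofReal_ne_zero.2 (Real.exp_pos _).ne'
  rw [hexp, div_mul_eq_mul_div, h, mul_div_cancel_left₀ _ hne]

theorem measurable_prod_fourier_increment (m : ℕ → ℤ) {τ : ℕ → ℝ≥0} (hτ : Monotone τ) (n : ℕ) :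
    Measurable[canonicalFiltration (τ n)] fun w => ∏ i ∈ Finset.range n,
      fourier (m i) (coord (τ (i + 1)) w - coord (τ i) w) := by
  refine Finset.measurable_fun_prod _ fun i hi => ?_
  have hi' := Finset.mem_range.1 hi
  exact (fourier (m i)).continuous.measurable.comp
    ((measurable_coord_of_le (hτ hi')).sub (measurable_coord_of_le (hτ hi'.le)))

/-- Induction on the number of increments: `fourier m (X_t - X_s)` is the product of
`fourier m X_t` and of `fourier (-m) X_s`, which is known at time `s`. -/
theorem IsGibbsLaw.integral_feynmanKac_smul_prod (hQ : IsGibbsLaw V lam F x Q)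
    (hV : Continuous V) (hF : IsC2 F) (hpos : ∀ x, 0 < F x) {τ : ℕ → ℝ≥0} (m : ℕ → ℤ)
    (hτ : Monotone τ) (h0 : τ 0 = 0) (n : ℕ) :
    ∫ w, feynmanKac (fun y => 1 / F y) (fun y => lam - V y) (τ n) w •
        ∏ i ∈ Finset.range n, fourier (m i) (coord (τ (i + 1)) w - coord (τ i) w) ∂Q =
      (F x : ℂ)⁻¹ *
        ∏ i ∈ Finset.range n, (Real.exp (-heatRate (m i) * (τ (i + 1) - τ i)) : ℂ) := by
  have := hQ.isProbabilityMeasure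
  induction n with
  | zero =>
    have hw : ∀ᵐ w ∂Q, feynmanKac (fun y => 1 / F y) (fun y => lam - V y) (τ 0) w •
        ∏ i ∈ Finset.range 0, fourier (m i) (coord (τ (i + 1)) w - coord (τ i) w) =
          (F x : ℂ)⁻¹ := by
      filter_upwards [hQ.start] with w hw
      rw [feynmanKac_coe, h0, hw]
      simp [pathIntegral]
    rw [integral_congr_ae hw]
    simp
  | succ n ih =>
    set H : PathSpace → ℂ := fun w => (∏ i ∈ Finset.range n,
      fourier (m i) (coord (τ (i + 1)) w - coord (τ i) w)) * fourier (-m n) (coord (τ n) w) with hH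
    have hHm : StronglyMeasurable[canonicalFiltration (τ n)] H :=
      ((measurable_prod_fourier_increment m hτ n).mul ((fourier (-m n)).continuous.measurable.comp
        (measurable_coord_of_le le_rfl))).stronglyMeasurable
    have hHb (w : PathSpace) : ‖H w‖ ≤ 1 := by
      simp only [hH, norm_mul, norm_prod, norm_fourier_apply]
      simp
    have hstep := hQ.integral_feynmanKac_smul_fourier hV hF hpos (m n) (hτ (Nat.le_succ n)) hHm hHb
    -- The factor `fourier (-m n) (X_{τ n})` of `H` turns positions into increments.
    have e1 (w : PathSpace) : H w * fourier (m n) (coord (τ (n + 1)) w) =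
        ∏ i ∈ Finset.range (n + 1), fourier (m i) (coord (τ (i + 1)) w - coord (τ i) w) := by
      rw [Finset.prod_range_succ, hH, sub_eq_add_neg, fourier_add_apply]
      have : fourier (-m n) (coord (τ n) w) = fourier (m n) (-coord (τ n) w) := by
        simp [fourier_apply]
      simp only [this]
      ring
    have e2 (w : PathSpace) : H w * fourier (m n) (coord (τ n) w) =
        ∏ i ∈ Finset.range n, fourier (m i) (coord (τ (i + 1)) w - coord (τ i) w) := by
      rw [hH, mul_assoc, ← fourier_add, neg_add_cancel, fourier_zero, mul_one]
    simp only [Nat.succ_eq_add_one, e1, e2] at hstep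
    rw [hstep, ih, Finset.prod_range_succ]
    ring

/-- `F(X_t) / F(X_0) * exp(-∫₀ᵗ (lam - V)(X_r) dr)`, the density on `𝓕_t` of the Gibbs law with
respect to the Brownian law. -/
noncomputable def gibbsDensity (V : M → ℝ) (lam : ℝ) (F : M → ℝ) (t : ℝ≥0) (w : PathSpace) : ℝ :=
  Real.exp (Real.log (F (coord t w)) - Real.log (F (coord 0 w)) -
    pathIntegral (fun y => lam - V y) t w)

theorem measurable_gibbsDensity (hV : Continuous V) (hF : Continuous F) (t : ℝ≥0) :
    Measurable[canonicalFiltration t] (gibbsDensity V lam F t) :=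
  Real.measurable_exp.comp
    (((Real.measurable_log.comp (hF.measurable.comp (measurable_coord_of_le le_rfl))).sub
      (Real.measurable_log.comp (hF.measurable.comp (measurable_coord_of_le zero_le)))).sub
      (measurable_pathIntegral (by fun_prop) t))

theorem inv_gibbsDensity (hpos : ∀ x, 0 < F x) (t : ℝ≥0) (w : PathSpace) :
    (gibbsDensity V lam F t w)⁻¹ =
      F (coord 0 w) * feynmanKac (fun y => 1 / F y) (fun y => lam - V y) t w := by
  rw [gibbsDensity, feynmanKac_coe, Real.exp_sub, Real.exp_sub, Real.exp_log (hpos _),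
    Real.exp_log (hpos _)]
  simp only [div_eq_mul_inv, mul_inv, inv_inv]
  ring

/-- Dividing the Gibbs law by `gibbsDensity` at time `T` gives a measure whose increments up to
time `T` are those of Brownian motion. -/
theorem IsGibbsLaw.hasHeatIncrements_withDensity (hQ : IsGibbsLaw V lam F x Q)
    (hV : Continuous V) (hF : IsC2 F) (hpos : ∀ x, 0 < F x) (T : ℝ≥0) :
    HasHeatIncrements T
      (Q.withDensity fun w => ENNReal.ofReal (gibbsDensity V lam F T w)⁻¹) := by
  intro n τ m hτ h0 hT
  have := hQ.isProbabilityMeasure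
  have hm : Measurable fun w => (gibbsDensity V lam F T w)⁻¹ :=
    ((measurable_gibbsDensity hV hF.continuous T).mono (canonicalFiltration.le T) le_rfl).inv
  rw [integral_withDensity_eq_integral_toReal_smul hm.ennreal_ofReal
    (.of_forall fun _ => ENNReal.ofReal_lt_top)]
  set H : PathSpace → ℂ := fun w =>
    ∏ i ∈ Finset.range n, fourier (m i) (coord (τ (i + 1)) w - coord (τ i) w)
  have hHm : StronglyMeasurable[canonicalFiltration (τ n)] H :=
    (measurable_prod_fourier_increment m hτ n).stronglyMeasurable
  have hHb (w : PathSpace) : ‖H w‖ ≤ 1 := by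
    simp only [H, norm_prod, norm_fourier_apply]
    simp
  -- The weight at time `T` is replaced by the weight at time `τ n`, as the weight is a martingale.
  have hmart := hQ.integral_feynmanKac_smul hV hF hpos (h := fun _ => 1) (κ := 0) contDiff_const
    (fun x => by simp [genL, circleDeriv]) (hT n) hHm hHb
  simp only [add_zero] at hmart
  have hw : ∀ᵐ w ∂Q, (ENNReal.ofReal (gibbsDensity V lam F T w)⁻¹).toReal • H w =
      (F x : ℂ) * feynmanKac (fun y => 1 / F y) (fun y => lam - V y) T w • H w := by
    filter_upwards [hQ.start] with w hw
    have h0 : 0 ≤ (gibbsDensity V lam F T w)⁻¹ := inv_nonneg.2 (Real.exp_pos _).le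
    rw [ENNReal.toReal_ofReal h0, inv_gibbsDensity hpos, hw, mul_smul, Complex.real_smul]
  rw [integral_congr_ae hw, integral_const_mul, hmart,
    hQ.integral_feynmanKac_smul_prod hV hF hpos m hτ h0 n, mul_inv_cancel_left₀]
  exact Complex.ofReal_ne_zero.2 (hpos x).ne'

theorem IsGibbsLaw.hasDensityOn (hQ : IsGibbsLaw V lam F x Q) (hV : Continuous V) (hF : IsC2 F)
    (hpos : ∀ x, 0 < F x) {P : Measure PathSpace} (hP : IsBrownianLaw x P) (t : ℝ≥0) :
    HasDensityOn t Q P fun w => ENNReal.ofReal (gibbsDensity V lam F t w) := by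
  have := hQ.isProbabilityMeasure
  have := hP.isProbabilityMeasure
  have hm := measurable_gibbsDensity (lam := lam) hV hF.continuous t
  have hmD : Measurable[canonicalFiltration t]
      fun w => ENNReal.ofReal (gibbsDensity V lam F t w) := hm.ennreal_ofReal
  have hmI : Measurable[canonicalFiltration t]
      fun w => ENNReal.ofReal (gibbsDensity V lam F t w)⁻¹ := hm.inv.ennreal_ofReal
  refine ⟨hmD, ?_⟩
  have hfin : IsFiniteMeasure
      (Q.withDensity fun w => ENNReal.ofReal (gibbsDensity V lam F t w)⁻¹) := by
    obtain ⟨K, hK⟩ := exists_abs_le_of_continuous hF.continuous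
    obtain ⟨K', hK'⟩ := exists_abs_le_of_continuous (f := fun y => 1 / F y)
      (continuous_const.div hF.continuous fun y => (hpos y).ne')
    obtain ⟨C, hC⟩ := exists_abs_le_of_continuous (f := fun y => lam - V y) (by fun_prop)
    refine isFiniteMeasure_withDensity_ofReal (Integrable.of_bound
      (hm.inv.mono (canonicalFiltration.le t) le_rfl).aestronglyMeasurable
      (K * (K' * Real.exp (C * t))) (.of_forall fun w => ?_)).hasFiniteIntegral
    rw [Real.norm_eq_abs, Pi.inv_apply, inv_gibbsDensity hpos, abs_mul]
    exact mul_le_mul (hK _) (abs_feynmanKac_le hK' hC t.2 le_rfl w) (abs_nonneg _)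
      ((abs_nonneg _).trans (hK 0))
  have htrim := (hP.hasHeatIncrements t).trim_eq
    (hQ.hasHeatIncrements_withDensity hV hF hpos t) hP.start
    ((withDensity_absolutelyContinuous _ _).ae_le hQ.start)
  rw [htrim, trim_withDensity _ hmI, ← withDensity_mul _ hmI hmD]
  have hone : (fun w => ENNReal.ofReal (gibbsDensity V lam F t w)⁻¹) *
      (fun w => ENNReal.ofReal (gibbsDensity V lam F t w)) = 1 := by
    funext w
    have h0 : 0 < gibbsDensity V lam F t w := Real.exp_pos _
    rw [Pi.mul_apply, ← ENNReal.ofReal_mul (inv_nonneg.2 h0.le), inv_mul_cancel₀ h0.ne']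
    simp
  rw [hone, withDensity_one]

/-- The eigenvalue equation in terms of `g = log F`: `½ (g'' + g'²) = lam - V`. -/
theorem circleDeriv_log (hF : IsC2 F) (hpos : ∀ x, 0 < F x)
    (heig : ∀ x, schrodinger V F x = lam * F x) (y : M) :
    circleDeriv (circleDeriv fun y => Real.log (F y)) y +
      circleDeriv (fun y => Real.log (F y)) y ^ 2 = 2 * (lam - V y) := by
  have hd : Differentiable ℝ fun z : ℝ => F (z : M) := ContDiff.differentiable hF (by norm_num)
  have hd' : Differentiable ℝ (deriv fun z : ℝ => F (z : M)) :=
    (ContDiff.differentiable_deriv_two hF)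
  have h1 : circleDeriv (fun y => Real.log (F y)) = fun y => circleDeriv F y / F y := by
    funext y
    induction y using QuotientAddGroup.induction_on with | H z
    rw [circleDeriv_coe, circleDeriv_coe]
    exact ((hd z).hasDerivAt.log (hpos _).ne').deriv
  have heq := heig y
  rw [schrodinger, genL] at heq
  rw [h1]
  induction y using QuotientAddGroup.induction_on with | H z
  have h2 : circleDeriv (circleDeriv F) (z : M) = deriv (deriv fun z : ℝ => F (z : M)) z := by
    rw [circleDeriv_coe]
    simp only [circleDeriv_coe]
  rw [h2] at heq
  rw [circleDeriv_coe]
  simp only [circleDeriv_coe]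
  have hne := (hpos (z : M)).ne'
  have h3 : deriv (fun z : ℝ => deriv (fun z : ℝ => F (z : M)) z / F (z : M)) z = _ :=
    ((hd' z).hasDerivAt.div (hd z).hasDerivAt hne).deriv
  rw [h3]
  field_simp
  linear_combination 2 * F (z : M) * heq

end Gibbs

end CircleGibbs

theorem mainTheorem3 (V : M → ℝ) (hV : ∃ K : ℝ≥0, LipschitzWith K V)
    (lam : ℝ) (F : M → ℝ) (hF : IsPrincipalEigenpair V lam F) :
    (∀ (x : M) (P Q : Measure PathSpace), IsBrownianLaw x P → IsGibbsLaw V lam F x Q →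
      ∀ t : ℝ≥0, HasDensityOn t Q P fun w => ENNReal.ofReal (Real.exp
        (Real.log (F (coord t w)) - Real.log (F (coord 0 w)) -
          pathIntegral (fun y => lam - V y) t w))) ∧
    (∀ P Q : M → Measure PathSpace, (∀ x, IsBrownianLaw x (P x)) →
      (∀ x, IsGibbsLaw V lam F x (Q x)) →
      IsAdmissibleWith P Q (fun y => Real.log (F y)) ∧ IsAdmissible P Q) := by
  obtain ⟨K, hK⟩ := hV
  have hdens {x : M} {P Q : Measure PathSpace} (hP : IsBrownianLaw x P)
      (hQ : IsGibbsLaw V lam F x Q) (t : ℝ≥0) :=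
    hQ.hasDensityOn hK.continuous hF.isC2 hF.pos hP t
  refine ⟨fun x P Q hP hQ t => hdens hP hQ t, fun P Q hP hQ => ?_⟩
  have hadm : IsAdmissibleWith P Q fun y => Real.log (F y) := by
    refine ⟨ContDiff.log hF.isC2 fun y => (hF.pos y).ne', fun x t => ?_⟩
    convert hdens (hP x) (hQ x) t using 5 with w
    simp only [gibbsDensity, circleDeriv_log hF.isC2 hF.pos hF.eigen, pathIntegral,
      intervalIntegral.integral_const_mul]
    ring_nf
  exact ⟨hadm, _, hadm⟩
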